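/- Let $\lambda\in(-\pi/2,\pi/2)$, let $\mathbb D=\{z\in\mathbb C:|z|<1\}$ and, for $n\ge 1$, put $$A_n=|1+ne^{-i\lambda}|+|1-ne^{-i\lambda}|,\qquad B=|1+e^{-i\lambda}|-|1-e^{-i\lambda}|.$$ A domain $\Omega\subset\mathbb C$ containing $0$ is called $\lambda$-spirallike if $w\,e^{-te^{i\lambda}}\in\Omega$ for all $w\in\Omega$ and all $t\ge 0$. An analytic function $F$ on $\mathbb D$ is called $\lambda$-spirallike if $F(0)=0$, $F$ is univalent on $\mathbb D$ and $F(\mathbb D)$ is a $\lambda$-spirallike domain (the value $F'(0)$ is not prescribed). A function $f=h+\overline g$ on $\mathbb D$, with $h(z)=z+\sum_{n\ge2}\alpha_nz^n$ and $g(z)=\sum_{n\ge1}\beta_nz^n$ analytic in $\mathbb D$, is called (harmonic) hereditarily $\lambda$-spirallike if it is sense-preserving, i.e. $|h'|^2-|g'|^2>0$ on $\mathbb D$, it is univalent on $\mathbb D$, and $f(\{|z|<r\})$ is a $\lambda$-spirallike domain for every $0<r<1$. **Theorem.** Let $(a_n)_{n\ge2}$, $(b_n)_{n\ge1}$ and $(d_n)_{n\ge1}$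 be sequences of complex numbers with $|b_1|<1$ and $|d_n|\le nB/A_n$ for all $n\ge1$, such that the series $$H(z)=z-\sum_{n=2}^\infty|a_n|z^n,\qquad G(z)=\sum_{n=1}^\infty|b_n|z^n$$ converge (hence define analytic functions) in $\mathbb D$. Suppose that for every $\epsilon\in\mathbb C$ with $|\epsilon|=1$ the function $$F_\epsilon(z)=z\left(\frac{H(z)+\epsilon G(z)}{z}\right)^{e^{i\lambda}\cos\lambda}$$ is analytic and $\lambda$-spirallike in $\mathbb D$; that is, $(H(z)+\epsilon G(z))/z$, extended analytically to $z=0$, has an analytic logarithm $L_\epsilon$ on $\mathbb D$ such that $F_\epsilon(z)=z\exp\left(e^{i\lambda}\cos\lambda\,L_\epsilon(z)\right)$ is $\lambda$-spirallike. Then the series below converge in $\mathbb D$ and $$f(z)=z+\sum_{n=2}^\infty d_na_nz^n+\overline{\sum_{n=1}^\infty d_nb_nz^n}$$ is a harmonic hereditarily $\lambda$-spirallike mapping. -/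

import Mathlib

open Complex Metric

/-- The sum `∑_{n ≥ m} c_n z^n`. -/
noncomputable def tailSeries (m : ℕ) (c : ℕ → ℂ) (z : ℂ) : ℂ :=
  ∑' n : ℕ, c (n + m) * z ^ (n + m)

/-- The series `∑_{n ≥ m} c_n z^n` converges in the open unit disk. -/
def TailConverges (m : ℕ) (c : ℕ → ℂ) : Prop :=
  ∀ z ∈ ball (0 : ℂ) 1, Summable fun n : ℕ => c (n + m) * z ^ (n + m)

/-- `A_n = |1 + n e^{-iλ}| + |1 - n e^{-iλ}|`. -/
noncomputable def spiralA (lam : ℝ) (n : ℕ) : ℝ :=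
  ‖1 + (n : ℂ) * exp (-(I * lam))‖ + ‖1 - (n : ℂ) * exp (-(I * lam))‖

/-- `B = |1 + e^{-iλ}| - |1 - e^{-iλ}|`. -/
noncomputable def spiralB (lam : ℝ) : ℝ :=
  ‖1 + exp (-(I * lam))‖ - ‖1 - exp (-(I * lam))‖

/-- `Ω` is a `λ`-spirallike domain: a domain containing the origin and, with each point `w`,
the arc `{w exp(-t e^{iλ}) : t ≥ 0}` of the `λ`-spiral from the origin to `w`. -/
structure IsSpirallikeDomain (lam : ℝ) (Ω : Set ℂ) : Prop where
  isOpen : IsOpen Ω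
  isConnected : IsConnected Ω
  zero_mem : (0 : ℂ) ∈ Ω
  spiral_mem : ∀ w ∈ Ω, ∀ t : ℝ, 0 ≤ t → w * exp (-(t * exp (I * lam))) ∈ Ω

/-- `F` is an analytic `λ`-spirallike function on the unit disk: analytic and univalent with
`F(0) = 0` and `F(𝔻)` a `λ`-spirallike domain. The value of `F'(0)` is not prescribed. -/
structure IsAnalyticSpirallike (lam : ℝ) (F : ℂ → ℂ) : Prop where
  analytic : AnalyticOnNhd ℂ F (ball 0 1)
  univalent : Set.InjOn F (ball 0 1)
  map_zero : F 0 = 0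
  image : IsSpirallikeDomain lam (F '' ball 0 1)

/-- `F(z) = z (K(z)/z)^α` on the unit disk, for an analytic branch of the power: `L` is an analytic
branch of `log (K(z)/z)`, with `K(z)/z` extended analytically to `z = 0`. -/
def IsPowerTransform (α : ℂ) (K F : ℂ → ℂ) : Prop :=
  ∃ L : ℂ → ℂ, AnalyticOnNhd ℂ L (ball 0 1) ∧
    (∀ z ∈ ball (0 : ℂ) 1, K z = z * exp (L z)) ∧
    ∀ z ∈ ball (0 : ℂ) 1, F z = z * exp (α * L z)

/-- The class of sense-preserving harmonic mappings `f = h + conj g` of the unit disk with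
`h(z) = z + ∑_{n ≥ 2} a_n z^n` and `g(z) = ∑_{n ≥ 1} b_n z^n` analytic. -/
def IsNormalizedHarmonic (f : ℂ → ℂ) : Prop :=
  ∃ h g : ℂ → ℂ, AnalyticOnNhd ℂ h (ball 0 1) ∧ AnalyticOnNhd ℂ g (ball 0 1) ∧
    h 0 = 0 ∧ deriv h 0 = 1 ∧ g 0 = 0 ∧
    (∀ z ∈ ball (0 : ℂ) 1, f z = h z + (starRingEnd ℂ) (g z)) ∧
    ∀ z ∈ ball (0 : ℂ) 1, 0 < ‖deriv h z‖ ^ 2 - ‖deriv g z‖ ^ 2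

/-- `f` is a harmonic hereditarily `λ`-spirallike mapping. -/
structure IsHereditarilySpirallike (lam : ℝ) (f : ℂ → ℂ) : Prop where
  harmonic : IsNormalizedHarmonic f
  univalent : Set.InjOn f (ball 0 1)
  image : ∀ r : ℝ, 0 < r → r < 1 → IsSpirallikeDomain lam (f '' ball 0 r)

/-! The coefficients meet through one inequality, `∑_{n≥2} n(|a_n| + |b_n|) ≤ 1 - |b_1|`.

Necessity: put `ε = -1`, so that `K = H - G` is real on `(0,1)` with every coefficient beyond the
linear one nonpositive. By the Schwarz lemma, flowing along `-e^{iλ}w` in the image of a spirallike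
`F` and pulling back never increases the modulus, whence `Re(e^{-iλ} zF'/F) ≥ 0` where `F' ≠ 0`. For
the power transform on `(0,1)` this real part is `cos λ · xK'/K`, so `K` is nondecreasing there, and
letting `x → 1` gives the inequality (`summable_and_tsum_le_of_isPowerTransform`).

Sufficiency: since `A_n|d_n| ≤ nB`, the new coefficients satisfy `∑_{n≥2} A_n(|α_n| + |β_n|) ≤ B -
A_1|β_1|`. With `D = zh' - conj(zg')`, the triangle inequality then gives `|f - e^{-iλ}D| < |f +
e^{-iλ}D|`, that is, `Re(e^{iλ} f conj D) > 0`: the pulled-back field points strictly into each disk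
`|z| < r`, so no spiral can leave its image (`isHereditarilySpirallike_of_tsum_le`,
`isSpirallikeDomain_image_ball`). -/

/-! ### Local inverses and one-sided derivative tests -/

open Filter Topology Set in
lemma continuousAt_invFunOn_of_isOpen_image {X Y : Type*} [TopologicalSpace X] [TopologicalSpace Y]
    [Nonempty X] {f : X → Y} {U : Set X} (hU : IsOpen U) (hinj : InjOn f U)
    (hopen : ∀ V ⊆ U, IsOpen V → IsOpen (f '' V)) {x : X} (hx : x ∈ U) :
    ContinuousAt (Function.invFunOn f U) (f x) := by
  rw [ContinuousAt, hinj.leftInvOn_invFunOn hx]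
  refine tendsto_def.2 fun s hs => ?_
  obtain ⟨V, hVs, hV, hxV⟩ := mem_nhds_iff.1 hs
  refine mem_of_superset ((hopen (V ∩ U) inter_subset_right (hV.inter hU)).mem_nhds
    ⟨x, ⟨hxV, hx⟩, rfl⟩) ?_
  rintro _ ⟨y, hy, rfl⟩
  rw [mem_preimage, hinj.leftInvOn_invFunOn hy.2]
  exact hVs hy.1

open Filter Topology in
lemma HasDerivAt.nonpos_of_eventually_le_right {u : ℝ → ℝ} {u' a : ℝ} (hu : HasDerivAt u u' a)
    (h : ∀ᶠ t in 𝓝[>] a, u t ≤ u a) : u' ≤ 0 := by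
  have ht := hasDerivAt_iff_tendsto_slope_left_right.1 hu
  refine le_of_tendsto ht.2 ?_
  filter_upwards [h, self_mem_nhdsWithin] with t h1 h2
  rw [slope_def_field]
  exact div_nonpos_of_nonpos_of_nonneg (by linarith) (by linarith [Set.mem_Ioi.1 h2])

open Filter Topology in
lemma HasDerivAt.nonneg_of_eventually_le_left {u : ℝ → ℝ} {u' a : ℝ} (hu : HasDerivAt u u' a)
    (h : ∀ᶠ t in 𝓝[<] a, u t ≤ u a) : 0 ≤ u' := by
  have ht := hasDerivAt_iff_tendsto_slope_left_right.1 hu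
  refine ge_of_tendsto ht.1 ?_
  filter_upwards [h, self_mem_nhdsWithin] with t h1 h2
  rw [slope_def_field]
  exact div_nonneg_of_nonpos (by linarith) (by linarith [Set.mem_Iio.1 h2])

lemma HasDerivAt.complex_normSq {u : ℝ → ℂ} {v : ℂ} {a : ℝ} (hu : HasDerivAt u v a) :
    HasDerivAt (fun t => ‖u t‖ ^ 2) (2 * ((starRingEnd ℂ) (u a) * v).re) a := by
  convert hu.norm_sq using 2
  simp [Complex.inner, mul_comm]

lemma hasDerivAt_spiral (lam : ℝ) (w : ℂ) (t : ℝ) :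
    HasDerivAt (fun t : ℝ => w * exp (-(t * exp (I * lam))))
      (-exp (I * lam) * (w * exp (-(t * exp (I * lam))))) t := by
  have h : HasDerivAt (fun t : ℝ => -((t : ℂ) * exp (I * lam))) (-(1 * exp (I * lam))) t :=
    ((Complex.ofRealCLM.hasDerivAt (x := t)).mul_const _).neg
  refine (h.cexp.const_mul w).congr_deriv ?_
  ring

/-! ### Analytic spirallike functions: infinitesimal criterion -/

open Topology in
lemma AnalyticOnNhd.isOpen_image_of_deriv_ne_zero {F : ℂ → ℂ} (hF : AnalyticOnNhd ℂ F (ball 0 1))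
    {z : ℂ} (hz : z ∈ ball (0 : ℂ) 1) (hd : deriv F z ≠ 0) :
    ∀ V ⊆ ball (0 : ℂ) 1, IsOpen V → IsOpen (F '' V) := by
  rcases hF.is_constant_or_isOpen (convex_ball 0 1).isPreconnected with ⟨w, hw⟩ | h
  · refine absurd ?_ hd
    have : F =ᶠ[𝓝 z] fun _ => w := by
      filter_upwards [isOpen_ball.mem_nhds hz] with y hy using hw y hy
    rw [this.deriv_eq, deriv_const]
  · exact h

open Filter Topology in
/-- The composition of an injective analytic function with multiplication by `c` and with its own
inverse does not increase the modulus. -/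
lemma norm_invFunOn_const_mul_le {F : ℂ → ℂ} (hF : AnalyticOnNhd ℂ F (ball 0 1))
    (hinj : Set.InjOn F (ball 0 1)) (h0 : F 0 = 0) {c : ℂ} (hc : c ≠ 0)
    (hmaps : ∀ w ∈ F '' ball 0 1, w * c ∈ F '' ball 0 1) {z₀ : ℂ} (hz₀ : z₀ ∈ ball (0 : ℂ) 1)
    (hd : deriv F z₀ ≠ 0) {z : ℂ} (hz : z ∈ ball (0 : ℂ) 1) :
    ‖Function.invFunOn F (ball 0 1) (F z * c)‖ ≤ ‖z‖ := by
  set g := Function.invFunOn F (ball (0 : ℂ) 1)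
  have hpre : IsPreconnected (ball (0 : ℂ) 1) := (convex_ball 0 1).isPreconnected
  have hopen : ∀ V ⊆ ball (0 : ℂ) 1, IsOpen V → IsOpen (F '' V) :=
    hF.isOpen_image_of_deriv_ne_zero hz₀ hd
  have hgm : ∀ x ∈ ball (0 : ℂ) 1, g (F x * c) ∈ ball (0 : ℂ) 1 ∧ F (g (F x * c)) = F x * c :=
    fun x hx => ⟨Function.invFunOn_mem (hmaps _ ⟨x, hx, rfl⟩),
      Function.invFunOn_eq (hmaps _ ⟨x, hx, rfl⟩)⟩
  have hgc : ∀ x ∈ ball (0 : ℂ) 1, ContinuousAt g (F x * c) := by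
    intro x hx
    rw [← (hgm x hx).2]
    exact continuousAt_invFunOn_of_isOpen_image isOpen_ball hinj hopen (hgm x hx).1
  have hφc : ∀ x ∈ ball (0 : ℂ) 1, ContinuousAt (fun y => g (F y * c)) x := fun x hx =>
    ContinuousAt.comp (g := g) (f := fun y => F y * c) (hgc x hx)
      ((hF x hx).continuousAt.mul continuousAt_const)
  have hφd : ∀ x ∈ ball (0 : ℂ) 1, deriv F (g (F x * c)) ≠ 0 →
      DifferentiableAt ℂ (fun y => g (F y * c)) x := by
    intro x hx hne
    have h1 : HasDerivAt g (deriv F (g (F x * c)))⁻¹ (F x * c) := by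
      refine HasDerivAt.of_local_left_inverse (hgc x hx)
        (hF _ (hgm x hx).1).differentiableAt.hasDerivAt hne ?_
      have : F '' ball 0 1 ∈ 𝓝 (F x * c) :=
        (hopen _ subset_rfl isOpen_ball).mem_nhds (hmaps _ ⟨x, hx, rfl⟩)
      filter_upwards [this] with y hy using Function.invFunOn_eq hy
    exact DifferentiableAt.comp x (g := g) (f := fun y => F y * c) h1.differentiableAt
      ((hF x hx).differentiableAt.mul_const c)
  -- Zeros of `F'` are isolated because `F'` does not vanish at `z₀`, so any exceptional points are
  -- removable by continuity.
  have hdiff : DifferentiableOn ℂ (fun y => g (F y * c)) (ball 0 1) := by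
    intro x hx
    refine DifferentiableAt.differentiableWithinAt (AnalyticAt.differentiableAt ?_)
    refine Complex.analyticAt_of_differentiable_on_punctured_nhds_of_continuousAt ?_ (hφc x hx)
    have hne : ∀ᶠ y in 𝓝[≠] (g (F x * c)), deriv F y ≠ 0 := by
      rcases (hF.deriv _ (hgm x hx).1).eventually_eq_zero_or_eventually_ne_zero with h | h
      · exact absurd (hF.deriv.eqOn_zero_of_preconnected_of_eventuallyEq_zero hpre (hgm x hx).1 h
          hz₀) hd
      · exact h
    -- Injectivity of `F` keeps nearby points off the possible zero of `F'`.
    have htend : Tendsto (fun y => g (F y * c)) (𝓝[≠] x) (𝓝[≠] (g (F x * c))) := by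
      refine tendsto_nhdsWithin_iff.2 ⟨(hφc x hx).tendsto.mono_left nhdsWithin_le_nhds, ?_⟩
      filter_upwards [self_mem_nhdsWithin, nhdsWithin_le_nhds (isOpen_ball.mem_nhds hx)]
        with y hy hyD heq
      refine hy (hinj hyD hx (mul_right_cancel₀ hc ?_))
      rw [← (hgm y hyD).2, ← (hgm x hx).2]
      exact congrArg F heq
    filter_upwards [htend.eventually hne, nhdsWithin_le_nhds (isOpen_ball.mem_nhds hx)]
      with y hy hyD using hφd y hyD hy
  have h00 : g (F 0 * c) = 0 := by
    have : g (F 0) = 0 := hinj.leftInvOn_invFunOn (mem_ball_self one_pos)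
    rw [h0] at this
    rw [h0, zero_mul, this]
  exact Complex.norm_le_norm_of_mapsTo_ball hdiff
    (fun x hx => ball_subset_closedBall (hgm x hx).1) h00 (mem_ball_zero_iff.1 hz)

open Filter Topology in
/-- The infinitesimal form of spirallikeness. -/
lemma IsAnalyticSpirallike.re_nonneg {lam : ℝ} {F : ℂ → ℂ} (hF : IsAnalyticSpirallike lam F)
    {z : ℂ} (hz : z ∈ ball (0 : ℂ) 1) (hd : deriv F z ≠ 0) :
    0 ≤ ((starRingEnd ℂ) z * (exp (I * lam) * F z / deriv F z)).re := by
  have hle : ∀ t : ℝ, 0 ≤ t →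
      ‖Function.invFunOn F (ball 0 1) (F z * exp (-(t * exp (I * lam))))‖ ≤ ‖z‖ := fun t ht =>
    norm_invFunOn_const_mul_le hF.analytic hF.univalent hF.map_zero (exp_ne_zero _)
      (fun w hw => hF.image.spiral_mem w hw t ht) hz hd hz
  have hinv : Function.invFunOn F (ball 0 1) (F z) = z := hF.univalent.leftInvOn_invFunOn hz
  have hopen : ∀ V ⊆ ball (0 : ℂ) 1, IsOpen V → IsOpen (F '' V) :=
    hF.analytic.isOpen_image_of_deriv_ne_zero hz hd
  have hg : HasDerivAt (Function.invFunOn F (ball 0 1)) (deriv F z)⁻¹ (F z) := by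
    refine HasDerivAt.of_local_left_inverse
      (continuousAt_invFunOn_of_isOpen_image isOpen_ball hF.univalent hopen hz)
      (by rw [hinv]; exact (hF.analytic z hz).differentiableAt.hasDerivAt) hd ?_
    filter_upwards [hF.image.isOpen.mem_nhds ⟨z, hz, rfl⟩] with y hy using Function.invFunOn_eq hy
  have hs := hasDerivAt_spiral lam (F z) 0
  have he : F z * exp (-((0 : ℝ) * exp (I * lam))) = F z := by simp
  rw [he] at hs
  have hc := (HasDerivAt.comp_of_eq (0 : ℝ) hg hs he.symm).complex_normSq
  -- The squared modulus of the pulled-back flow is largest at `t = 0`, where the flow has velocity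
  -- `-e^{iλ}F/F'`.
  have h := hc.nonpos_of_eventually_le_right (by
    filter_upwards [self_mem_nhdsWithin] with t ht
    have := hle t (le_of_lt ht)
    simp only [Function.comp_apply, he, hinv]
    gcongr)
  simp only [Function.comp_apply, he, hinv] at h
  have heq : (starRingEnd ℂ) z * ((deriv F z)⁻¹ * (-exp (I * lam) * F z)) =
      -((starRingEnd ℂ) z * (exp (I * lam) * F z / deriv F z)) := by
    rw [div_eq_mul_inv]; ring
  rw [heq, neg_re] at h
  linarith

/-! ### From an inward vector field to spirallike images -/

open Filter Topology in
/-- If the vector field `w ↦ -e^{iλ} w`, pulled back by the local diffeomorphism `f`, points strictly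
into every disk centred at the origin, then `f` maps these disks to spirallike domains. -/
lemma isSpirallikeDomain_image_ball {lam : ℝ} {f : ℂ → ℂ} {f' : ℂ → ℂ →L[ℝ] ℂ}
    (hf : ∀ z ∈ ball (0 : ℂ) 1, HasStrictFDerivAt f (f' z) z) (hinj : Set.InjOn f (ball 0 1))
    (h0 : f 0 = 0) (hf' : ∀ z ∈ ball (0 : ℂ) 1, Function.Injective (f' z))
    (hdir : ∀ z ∈ ball (0 : ℂ) 1, z ≠ 0 → ∀ v, f' z v = -exp (I * lam) * f z →
      ((starRingEnd ℂ) z * v).re < 0) {r : ℝ} (hr : 0 < r) (hr1 : r < 1) :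
    IsSpirallikeDomain lam (f '' ball 0 r) := by
  have hsub : ball (0 : ℂ) r ⊆ ball 0 1 := ball_subset_ball hr1.le
  have hcont : ContinuousOn f (ball 0 1) := fun z hz => (hf z hz).continuousAt.continuousWithinAt
  have hequiv : ∀ z ∈ ball (0 : ℂ) 1, ∃ e : ℂ ≃L[ℝ] ℂ, (e : ℂ →L[ℝ] ℂ) = f' z := fun z hz =>
    ⟨(LinearEquiv.ofInjectiveEndo (f' z : ℂ →ₗ[ℝ] ℂ) (hf' z hz)).toContinuousLinearEquiv, by
      ext; rfl⟩
  have hopen : ∀ V ⊆ ball (0 : ℂ) 1, IsOpen V → IsOpen (f '' V) := by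
    intro V hV hVo
    rw [isOpen_iff_mem_nhds]
    rintro _ ⟨z, hz, rfl⟩
    obtain ⟨e, he⟩ := hequiv z (hV hz)
    have := hf z (hV hz)
    rw [← he] at this
    rw [← this.map_nhds_eq_of_equiv]
    exact image_mem_map (hVo.mem_nhds hz)
  have hopr : IsOpen (f '' ball 0 r) := hopen _ hsub isOpen_ball
  refine ⟨hopr, ?_, ⟨0, mem_ball_self hr, h0⟩, ?_⟩
  · exact (((convex_ball 0 r).isConnected ⟨0, mem_ball_self hr⟩)).image f (hcont.mono hsub)
  intro w hw t₁ ht₁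
  by_contra hout
  set γ : ℝ → ℂ := fun t => w * exp (-(t * exp (I * lam)))
  have hγ : Continuous γ := by fun_prop
  set S : Set ℝ := {t | 0 ≤ t ∧ γ t ∉ f '' ball 0 r}
  have hSc : IsClosed S := isClosed_Ici.inter (hopr.isClosed_compl.preimage hγ)
  have hSb : BddBelow S := ⟨0, fun t ht => ht.1⟩
  -- First exit time. The exit point is in the compact image of the closed disk but not in that of
  -- the open one, so its preimage has modulus exactly `r`.
  set T := sInf S
  have hT : T ∈ S := hSc.csInf_mem ⟨t₁, ht₁, hout⟩ hSb
  have hT0 : 0 < T := by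
    refine lt_of_le_of_ne hT.1 fun h => hT.2 ?_
    rw [← h]
    simpa [γ] using hw
  have hbefore : ∀ s, 0 ≤ s → s < T → γ s ∈ f '' ball 0 r := fun s hs hsT => by
    by_contra h
    exact absurd (csInf_le hSb ⟨hs, h⟩) (not_le.2 hsT)
  have hev : ∀ᶠ s in 𝓝[<] T, γ s ∈ f '' ball 0 r := by
    filter_upwards [self_mem_nhdsWithin, nhdsWithin_le_nhds (lt_mem_nhds hT0)] with s h1 h2
      using hbefore s (le_of_lt h2) h1
  have hcl : IsClosed (f '' closedBall 0 r) :=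
    ((isCompact_closedBall 0 r).image_of_continuousOn
      (hcont.mono (closedBall_subset_ball hr1))).isClosed
  obtain ⟨z, hzr, hzT⟩ : γ T ∈ f '' closedBall 0 r :=
    hcl.mem_of_tendsto (hγ.continuousAt.tendsto.mono_left nhdsWithin_le_nhds)
      (hev.mono fun s hs => Set.image_mono ball_subset_closedBall hs)
  have hzn : ‖z‖ = r := by
    refine le_antisymm (mem_closedBall_zero_iff.1 hzr) (not_lt.1 fun h => hT.2 ?_)
    exact ⟨z, mem_ball_zero_iff.2 h, hzT⟩
  have hz1 : z ∈ ball (0 : ℂ) 1 := closedBall_subset_ball hr1 hzr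
  have hz0 : z ≠ 0 := norm_pos_iff.1 (hzn ▸ hr)
  have hinv : ∀ y ∈ ball (0 : ℂ) 1, Function.invFunOn f (ball 0 1) (f y) = y :=
    fun y hy => hinj.leftInvOn_invFunOn hy
  obtain ⟨e, he⟩ := hequiv z hz1
  have hg : HasFDerivAt (Function.invFunOn f (ball 0 1)) (e.symm : ℂ →L[ℝ] ℂ) (f z) := by
    refine HasFDerivAt.of_local_left_inverse
      (continuousAt_invFunOn_of_isOpen_image isOpen_ball hinj hopen hz1)
      (by rw [hinv z hz1, he]; exact (hf z hz1).hasFDerivAt) ?_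
    filter_upwards [(hopen _ subset_rfl isOpen_ball).mem_nhds ⟨z, hz1, rfl⟩] with y hy
      using Function.invFunOn_eq hy
  have hc := (HasFDerivAt.comp_hasDerivAt_of_eq T hg (hasDerivAt_spiral lam w T)
    hzT).complex_normSq
  have hneg := hdir z hz1 hz0 (e.symm (-exp (I * lam) * γ T)) (by
    rw [← he, ← hzT]; exact e.apply_symm_apply _)
  -- Just before `T` the preimage has modulus below `r`, and at `T` it equals `r`; the derivative
  -- there is thus nonnegative, against `hneg`.
  have hnn := hc.nonneg_of_eventually_le_left (by
    filter_upwards [hev] with s hs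
    obtain ⟨y, hy, hys⟩ := hs
    change ‖Function.invFunOn f (ball 0 1) (γ s)‖ ^ 2 ≤ ‖Function.invFunOn f (ball 0 1) (γ T)‖ ^ 2
    rw [← hys, ← hzT, hinv y (hsub hy), hinv z hz1, hzn]
    have := (mem_ball_zero_iff.1 hy).le
    gcongr)
  change 0 ≤ 2 * ((starRingEnd ℂ) (Function.invFunOn f (ball 0 1) (γ T)) *
    e.symm (-exp (I * lam) * γ T)).re at hnn
  rw [← hzT, hinv z hz1, hzT] at hnn
  linarith

/-! ### Coefficient inequality from the power transform -/

open Filter Topology in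
/-- A power series `x - b x - ∑ c_n x^{n+2}` with `c_n ≥ 0` that is nondecreasing on `(0,1)` has
`∑ (n+2) c_n ≤ 1 - b`. -/
lemma summable_and_tsum_le_of_monotoneOn {c : ℕ → ℝ} {b : ℝ} (hc : ∀ n, 0 ≤ c n)
    (hsum : ∀ x ∈ Set.Ioo (0 : ℝ) 1, Summable fun n : ℕ => c n * x ^ (n + 2))
    (hmono : MonotoneOn (fun x : ℝ => x - b * x - ∑' n : ℕ, c n * x ^ (n + 2)) (Set.Ioo 0 1)) :
    (Summable fun n : ℕ => ((n : ℝ) + 2) * c n) ∧ ∑' n : ℕ, ((n : ℝ) + 2) * c n ≤ 1 - b := by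
  have key : ∀ N : ℕ, ∀ r ∈ Set.Ioo (0 : ℝ) 1,
      ∑ n ∈ Finset.range N, ((n : ℝ) + 2) * c n * r ^ (n + 1) ≤ 1 - b := by
    intro N r hr
    obtain ⟨s, hrs, hs1⟩ := exists_between hr.2
    have hs : s ∈ Set.Ioo (0 : ℝ) 1 := ⟨hr.1.trans hrs, hs1⟩
    -- Convexity of `x^{n+2}`: the tangent at `r` lies below the graph. Difference quotients thus
    -- replace termwise differentiation.
    have hpow : ∀ n : ℕ, ((n : ℝ) + 2) * r ^ (n + 1) * (s - r) ≤ s ^ (n + 2) - r ^ (n + 2) := by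
      intro n
      induction n with
      | zero => norm_num; nlinarith [sq_nonneg (s - r)]
      | succ n ih =>
        have h1 : 0 ≤ r ^ (n + 2) := pow_nonneg hr.1.le _
        have h2 := mul_le_mul_of_nonneg_left ih hr.1.le
        have h3 : r ^ (n + 2) ≤ s ^ (n + 2) := pow_le_pow_left₀ hr.1.le hrs.le _
        have h4 := mul_le_mul_of_nonneg_right h3 (sub_nonneg.2 hrs.le)
        push_cast
        calc ((n : ℝ) + 1 + 2) * r ^ (n + 1 + 1) * (s - r)
            = r * (((n : ℝ) + 2) * r ^ (n + 1) * (s - r)) + r ^ (n + 2) * (s - r) := by ring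
          _ ≤ r * (s ^ (n + 2) - r ^ (n + 2)) + s ^ (n + 2) * (s - r) := add_le_add h2 h4
          _ = s ^ (n + 1 + 2) - r ^ (n + 1 + 2) := by ring
    have hm := hmono hr hs hrs.le
    have hd := (hsum s hs).sub (hsum r hr)
    have ht : ∑' n : ℕ, (c n * s ^ (n + 2) - c n * r ^ (n + 2)) ≤ (1 - b) * (s - r) := by
      rw [(hsum s hs).tsum_sub (hsum r hr)]
      simp only at hm
      linarith
    have hle : ∑ n ∈ Finset.range N, (c n * s ^ (n + 2) - c n * r ^ (n + 2)) ≤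
        ∑' n : ℕ, (c n * s ^ (n + 2) - c n * r ^ (n + 2)) := by
      refine hd.sum_le_tsum _ fun n _ => ?_
      have : r ^ (n + 2) ≤ s ^ (n + 2) := pow_le_pow_left₀ hr.1.le hrs.le _
      nlinarith [hc n]
    refine le_of_mul_le_mul_right ?_ (sub_pos.2 hrs)
    refine le_trans ?_ (hle.trans ht)
    rw [Finset.sum_mul]
    refine Finset.sum_le_sum fun n _ => ?_
    have := mul_le_mul_of_nonneg_left (hpow n) (hc n)
    linarith
  have key' : ∀ N : ℕ, ∑ n ∈ Finset.range N, ((n : ℝ) + 2) * c n ≤ 1 - b := by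
    intro N
    have hcont : Continuous fun r : ℝ =>
        ∑ n ∈ Finset.range N, ((n : ℝ) + 2) * c n * r ^ (n + 1) := by fun_prop
    have ht := (hcont.tendsto 1).mono_left (nhdsWithin_le_nhds (s := Set.Iio 1))
    simp only [one_pow, mul_one] at ht
    refine le_of_tendsto ht ?_
    filter_upwards [Ioo_mem_nhdsLT (zero_lt_one' ℝ)] with r hr using key N r hr
  have hnn : ∀ n : ℕ, 0 ≤ ((n : ℝ) + 2) * c n := fun n => mul_nonneg (by positivity) (hc n)
  exact ⟨summable_of_sum_range_le hnn key', Real.tsum_le_of_sum_range_le hnn key'⟩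

/-- A function that is real on `(0,1)` has real derivatives there. -/
lemma im_eq_zero_of_hasDerivAt {K : ℂ → ℂ} {K' : ℂ} {x : ℝ} (hx : x ∈ Set.Ioo (0 : ℝ) 1)
    (hreal : ∀ y ∈ Set.Ioo (0 : ℝ) 1, (K y).im = 0) (hK : HasDerivAt K K' x) : K'.im = 0 := by
  have h1 : HasDerivAt (fun y : ℝ => (K y).im) K'.im x :=
    Complex.imCLM.hasFDerivAt.comp_hasDerivAt x hK.comp_ofReal
  have h2 : (fun y : ℝ => (K y).im) =ᶠ[nhds x] fun _ => 0 := by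
    filter_upwards [isOpen_Ioo.mem_nhds hx] with y hy using hreal y hy
  rw [← h1.deriv, h2.deriv_eq, deriv_const]

/-- If the power transform of `K` is spirallike and `K` is positive on `(0,1)`, then `K` is
nondecreasing there. -/
lemma monotoneOn_of_isPowerTransform {lam : ℝ}
    (hlam : lam ∈ Set.Ioo (-(Real.pi / 2)) (Real.pi / 2)) {K F : ℂ → ℂ}
    (hT : IsPowerTransform (exp (I * lam) * (Real.cos lam : ℂ)) K F)
    (hF : IsAnalyticSpirallike lam F)
    (hreal : ∀ x ∈ Set.Ioo (0 : ℝ) 1, (K x).im = 0)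
    (hpos : ∃ x ∈ Set.Ioo (0 : ℝ) 1, 0 < (K x).re) :
    MonotoneOn (fun x : ℝ => (K x).re) (Set.Ioo 0 1) := by
  obtain ⟨L, hL, hKL, hFL⟩ := hT
  set α : ℂ := exp (I * lam) * (Real.cos lam : ℂ) with hα
  have hcos : 0 < Real.cos lam := Real.cos_pos_of_mem_Ioo hlam
  have hmem : ∀ x ∈ Set.Ioo (0 : ℝ) 1, (x : ℂ) ∈ ball (0 : ℂ) 1 := fun x hx => by
    simpa [abs_of_pos hx.1] using hx.2
  have hexpd : ∀ (β : ℂ) (G : ℂ → ℂ), (∀ z ∈ ball (0 : ℂ) 1, G z = z * exp (β * L z)) →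
      ∀ z ∈ ball (0 : ℂ) 1, HasDerivAt G (exp (β * L z) * (1 + β * (z * deriv L z))) z := by
    intro β G hG z hz
    have h : HasDerivAt (fun z => z * exp (β * L z)) _ z :=
      (hasDerivAt_id z).mul (((hL z hz).differentiableAt.hasDerivAt).const_mul β).cexp
    refine (h.congr_of_eventuallyEq ?_).congr_deriv ?_
    · filter_upwards [isOpen_ball.mem_nhds hz] with y hy using hG y hy
    · simp only [id]; ring
  have hKd := hexpd 1 K (fun z hz => by rw [one_mul]; exact hKL z hz)
  have hFd := hexpd α F hFL
  simp only [one_mul] at hKd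
  have hkd : ∀ x ∈ Set.Ioo (0 : ℝ) 1, HasDerivAt (fun x : ℝ => (K x).re)
      (exp (L x) * (1 + (x * deriv L x))).re x := fun x hx => (hKd x (hmem x hx)).real_of_complex
  have hKne : ∀ x ∈ Set.Ioo (0 : ℝ) 1, (K x).re ≠ 0 := by
    intro x hx h
    have : K x = 0 := Complex.ext h (hreal x hx)
    rw [hKL x (hmem x hx)] at this
    exact (mul_ne_zero (ofReal_ne_zero.2 hx.1.ne') (exp_ne_zero _)) this
  have hKcont : ContinuousOn (fun x : ℝ => (K x).re) (Set.Ioo 0 1) := fun x hx =>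
    (hkd x hx).continuousAt.continuousWithinAt
  -- `K = z exp L` has no zero on `(0,1)`, so its sign is constant.
  have hKpos : ∀ x ∈ Set.Ioo (0 : ℝ) 1, 0 < (K x).re := by
    obtain ⟨x₀, hx₀, h₀⟩ := hpos
    intro x hx
    by_contra h
    obtain ⟨y, hy, hy0⟩ := isPreconnected_Ioo.intermediate_value hx hx₀ hKcont
      ⟨not_lt.1 h, h₀.le⟩
    exact hKne y hy hy0
  refine monotoneOn_of_deriv_nonneg (convex_Ioo 0 1) hKcont
    (fun x hx => ?_) (fun x hx => ?_)
  · rw [interior_Ioo] at hx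
    exact (hkd x hx).differentiableAt.differentiableWithinAt
  rw [interior_Ioo] at hx
  rw [(hkd x hx).deriv]
  -- Assuming `K' < 0` strictly also yields `Re q < 0` below, hence `F' ≠ 0`, which the
  -- infinitesimal criterion requires.
  by_contra! hneg
  have hE : exp (L x) = (((K x).re / x : ℝ) : ℂ) := by
    have h1 : K x = ((K x).re : ℂ) := Complex.ext (by simp) (by simpa using hreal x hx)
    have h2 := hKL x (hmem x hx)
    have hx0 : (x : ℂ) ≠ 0 := ofReal_ne_zero.2 hx.1.ne'
    rw [ofReal_div, ← h1, h2]
    field_simp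
  have hEpos : 0 < (K x).re / x := div_pos (hKpos x hx) hx.1
  have him := im_eq_zero_of_hasDerivAt hx hreal (hKd x (hmem x hx))
  rw [hE, re_ofReal_mul] at hneg
  rw [hE, im_ofReal_mul] at him
  set u : ℂ := x * deriv L x
  have hu_im : u.im = 0 := by
    have := (mul_eq_zero.1 him).resolve_left hEpos.ne'
    simpa using this
  have hu_re : 1 + u.re < 0 := by
    have := neg_of_mul_neg_right hneg hEpos.le
    simpa using this
  have hu : u = (u.re : ℂ) := Complex.ext (by simp) (by simpa using hu_im)
  set e : ℂ := exp (I * lam)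
  have he0 : e ≠ 0 := exp_ne_zero _
  have he : e = Real.cos lam + Real.sin lam * I := by
    simp only [e, mul_comm I, exp_mul_I, ofReal_cos, ofReal_sin]
  set q : ℂ := (Real.cos lam * (1 + u.re) : ℝ) - (Real.sin lam : ℝ) * I with hq
  have hq_re : q.re = Real.cos lam * (1 + u.re) := by simp [hq, -ofReal_cos, -ofReal_sin]
  -- Here `1 + αu = xF'/F` and `1 + u = xK'/K`. The exponent `e^{iλ} cos λ` is what makes
  -- `Re(e^{-iλ} xF'/F)` equal to `cos λ (1 + u)`.
  have hαu : 1 + α * u = e * q := by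
    rw [hα, hu, hq, he]
    have hsc : (Real.sin lam : ℂ) ^ 2 + (Real.cos lam : ℂ) ^ 2 = 1 := by
      exact_mod_cast Real.sin_sq_add_cos_sq lam
    push_cast [-ofReal_cos, -ofReal_sin]
    generalize (Real.sin lam : ℂ) = s at *
    generalize (Real.cos lam : ℂ) = c at *
    have hI : I ^ 2 = -1 := I_sq
    linear_combination (-1 : ℂ) * hsc + s ^ 2 * hI
  have hq0 : q ≠ 0 := fun h => by
    have : q.re = 0 := by rw [h]; rfl
    rw [hq_re] at this
    nlinarith
  have hFx := hFd x (hmem x hx)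
  have hFne : deriv F x ≠ 0 := by
    rw [hFx.deriv]
    exact mul_ne_zero (exp_ne_zero _) (by rw [hαu]; exact mul_ne_zero he0 hq0)
  have hre := hF.re_nonneg (hmem x hx) hFne
  have hval : (starRingEnd ℂ) (x : ℂ) * (e * F x / deriv F x) = ((x ^ 2 : ℝ) : ℂ) * q⁻¹ := by
    rw [hFx.deriv, hFL x (hmem x hx), conj_ofReal]
    change _ * (_ / (_ * (1 + α * u))) = _
    rw [hαu]
    have := exp_ne_zero (α * L x)
    push_cast
    field_simp
  change 0 ≤ ((starRingEnd ℂ) (x : ℂ) * (e * F x / deriv F x)).re at hre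
  rw [hval, re_ofReal_mul, inv_re, hq_re] at hre
  have h1 : 0 < normSq q := normSq_pos.2 hq0
  have h2 : Real.cos lam * (1 + u.re) / normSq q < 0 :=
    div_neg_of_neg_of_pos (mul_neg_of_pos_of_neg hcos hu_re) h1
  have h3 : (0 : ℝ) < x ^ 2 := pow_pos hx.1 2
  nlinarith

/-- The coefficient inequality forced by spirallikeness of the power transform of `H - G`. -/
lemma summable_and_tsum_le_of_isPowerTransform {lam : ℝ}
    (hlam : lam ∈ Set.Ioo (-(Real.pi / 2)) (Real.pi / 2)) {a b : ℕ → ℂ} {H G F : ℂ → ℂ}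
    (hHconv : TailConverges 2 (fun n => (‖a n‖ : ℂ)))
    (hH : ∀ z ∈ ball (0 : ℂ) 1, H z = z - tailSeries 2 (fun n => (‖a n‖ : ℂ)) z)
    (hGconv : TailConverges 1 (fun n => (‖b n‖ : ℂ)))
    (hG : ∀ z ∈ ball (0 : ℂ) 1, G z = tailSeries 1 (fun n => (‖b n‖ : ℂ)) z)
    (hb1 : ‖b 1‖ < 1)
    (hT : IsPowerTransform (exp (I * lam) * (Real.cos lam : ℂ)) (fun z => H z + (-1) * G z) F)
    (hF : IsAnalyticSpirallike lam F) :
    (Summable fun n : ℕ => ((n : ℝ) + 2) * (‖a (n + 2)‖ + ‖b (n + 2)‖)) ∧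
      ∑' n : ℕ, ((n : ℝ) + 2) * (‖a (n + 2)‖ + ‖b (n + 2)‖) ≤ 1 - ‖b 1‖ := by
  have hmem : ∀ x ∈ Set.Ioo (0 : ℝ) 1, (x : ℂ) ∈ ball (0 : ℂ) 1 := fun x hx => by
    simpa [abs_of_pos hx.1] using hx.2
  have hA : ∀ x ∈ Set.Ioo (0 : ℝ) 1, Summable fun n : ℕ => ‖a (n + 2)‖ * x ^ (n + 2) :=
    fun x hx => by
      have := hHconv x (hmem x hx)
      beta_reduce at this
      exact_mod_cast this
  have hB1 : ∀ x ∈ Set.Ioo (0 : ℝ) 1, Summable fun n : ℕ => ‖b (n + 1)‖ * x ^ (n + 1) :=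
    fun x hx => by
      have := hGconv x (hmem x hx)
      beta_reduce at this
      exact_mod_cast this
  have hB : ∀ x ∈ Set.Ioo (0 : ℝ) 1, Summable fun n : ℕ => ‖b (n + 2)‖ * x ^ (n + 2) :=
    fun x hx => (summable_nat_add_iff (f := fun n => ‖b (n + 1)‖ * x ^ (n + 1)) 1).2 (hB1 x hx)
  have hsum : ∀ x ∈ Set.Ioo (0 : ℝ) 1,
      Summable fun n : ℕ => (‖a (n + 2)‖ + ‖b (n + 2)‖) * x ^ (n + 2) := fun x hx => by
    simpa only [add_mul] using (hA x hx).add (hB x hx)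
  have hK : ∀ x ∈ Set.Ioo (0 : ℝ) 1, H x + (-1) * G x =
      ((x - ‖b 1‖ * x - ∑' n : ℕ, (‖a (n + 2)‖ + ‖b (n + 2)‖) * x ^ (n + 2) : ℝ) : ℂ) := by
    intro x hx
    have h1 : tailSeries 2 (fun n => (‖a n‖ : ℂ)) x =
        ((∑' n : ℕ, ‖a (n + 2)‖ * x ^ (n + 2) : ℝ) : ℂ) := by
      rw [tailSeries]; push_cast; rfl
    have h2 : tailSeries 1 (fun n => (‖b n‖ : ℂ)) x =
        ((∑' n : ℕ, ‖b (n + 1)‖ * x ^ (n + 1) : ℝ) : ℂ) := by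
      rw [tailSeries]; push_cast; rfl
    have h3 := (hB1 x hx).tsum_eq_zero_add
    simp only [zero_add, pow_one] at h3
    simp only [add_mul]
    rw [hH x (hmem x hx), hG x (hmem x hx), h1, h2, h3, (hA x hx).tsum_add (hB x hx)]
    push_cast
    ring
  have hmono := monotoneOn_of_isPowerTransform hlam hT hF
    (fun x hx => by simp only [hK x hx, ofReal_im]) ?_
  · refine summable_and_tsum_le_of_monotoneOn (fun n => by positivity) hsum ?_
    refine hmono.congr fun x hx => ?_
    simp only [hK x hx, ofReal_re]
  -- For `x ≤ 1/2` the tail is at most `4Cx²`, so `K(x) > 0` once `4Cx < 1 - |b_1|`; the `+ 1` in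
  -- the witness avoids division by zero.
  · set C := ∑' n : ℕ, (‖a (n + 2)‖ + ‖b (n + 2)‖) * (1 / 2 : ℝ) ^ (n + 2)
    have hC : 0 ≤ C := tsum_nonneg fun n => by positivity
    have hb : 0 < 1 - ‖b 1‖ := by linarith
    set x : ℝ := min (1 / 2) ((1 - ‖b 1‖) / (4 * C + 1) / 2)
    have hx0 : 0 < x := lt_min (by norm_num) (by positivity)
    have hx2 : x ≤ 1 / 2 := min_le_left _ _
    have hxC : (4 * C + 1) * x < 1 - ‖b 1‖ := by
      have h4 : 0 < 4 * C + 1 := by positivity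
      have : x < (1 - ‖b 1‖) / (4 * C + 1) :=
        (min_le_right _ _).trans_lt (half_lt_self (by positivity))
      rw [lt_div_iff₀ h4] at this
      linarith
    have hx : x ∈ Set.Ioo (0 : ℝ) 1 := ⟨hx0, by linarith⟩
    refine ⟨x, hx, ?_⟩
    simp only [hK x hx, ofReal_re]
    have hle : ∑' n : ℕ, (‖a (n + 2)‖ + ‖b (n + 2)‖) * x ^ (n + 2) ≤ C * (2 * x) ^ 2 := by
      rw [← tsum_mul_right]
      refine (hsum x hx).tsum_le_tsum (fun n => ?_)
        ((hsum (1 / 2) (by norm_num)).mul_right _)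
      rw [mul_assoc]
      refine mul_le_mul_of_nonneg_left ?_ (by positivity)
      have h5 : (2 * x) ^ (n + 2) ≤ (2 * x) ^ 2 :=
        pow_le_pow_of_le_one (by positivity) (by linarith) (by omega)
      calc x ^ (n + 2) = (1 / 2) ^ (n + 2) * (2 * x) ^ (n + 2) := by
            rw [← mul_pow]; congr 1; ring
        _ ≤ _ := by gcongr
    nlinarith

/-! ### Estimates for tail series -/

lemma norm_natCast_add_two (n : ℕ) : ‖(n : ℂ) + 2‖ = (n : ℝ) + 2 := by
  exact_mod_cast norm_natCast (n + 2)

lemma summable_tailSeries_two {c : ℕ → ℂ} (hc : Summable fun n : ℕ => ((n : ℝ) + 2) * ‖c (n + 2)‖)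
    {z : ℂ} (hz : ‖z‖ ≤ 1) : Summable fun n : ℕ => c (n + 2) * z ^ (n + 2) := by
  refine Summable.of_norm_bounded hc fun n => ?_
  rw [norm_mul, norm_pow, mul_comm]
  gcongr
  exact (pow_le_one₀ (norm_nonneg _) hz).trans (by linarith [n.cast_nonneg (α := ℝ)])

lemma tailSeries_one_eq {c : ℕ → ℂ} (hc : Summable fun n : ℕ => ((n : ℝ) + 2) * ‖c (n + 2)‖)
    {z : ℂ} (hz : ‖z‖ ≤ 1) : tailSeries 1 c z = c 1 * z + tailSeries 2 c z := by
  have h := (summable_nat_add_iff (f := fun n => c (n + 1) * z ^ (n + 1)) 1).1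
    (summable_tailSeries_two hc hz)
  simpa [tailSeries] using h.tsum_eq_zero_add

lemma hasDerivAt_tailSeries_two {c : ℕ → ℂ}
    (hc : Summable fun n : ℕ => ((n : ℝ) + 2) * ‖c (n + 2)‖) {z : ℂ} (hz : z ∈ ball (0 : ℂ) 1) :
    HasDerivAt (tailSeries 2 c) (∑' n : ℕ, ((n : ℂ) + 2) * c (n + 2) * z ^ (n + 1)) z := by
  have h0 : Summable fun n : ℕ => c (n + 2) * (0 : ℂ) ^ (n + 2) :=
    summable_tailSeries_two hc (by simp)
  refine hasDerivAt_tsum_of_isPreconnected (y₀ := 0)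
    (g := fun (n : ℕ) z => c (n + 2) * z ^ (n + 2))
    (g' := fun (n : ℕ) z => ((n : ℂ) + 2) * c (n + 2) * z ^ (n + 1)) hc isOpen_ball
    (convex_ball 0 1).isPreconnected (fun n y _ => ?_) (fun n y hy => ?_)
    (mem_ball_self one_pos) h0 hz
  · refine ((hasDerivAt_pow (n + 2) y).const_mul (c (n + 2))).congr_deriv ?_
    simp only [Nat.add_succ_sub_one]
    push_cast
    ring
  · rw [norm_mul, norm_mul, norm_pow, norm_natCast_add_two]
    exact mul_le_of_le_one_right (by positivity)
      (pow_le_one₀ (norm_nonneg _) (mem_ball_zero_iff.1 hy).le)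

/-- Termwise bound for the combination `T + μ z T'` of a tail series and its Euler derivative. -/
lemma norm_tailSeries_two_add_le {c : ℕ → ℂ}
    (hc : Summable fun n : ℕ => ((n : ℝ) + 2) * ‖c (n + 2)‖) {μ : ℂ}
    (hμ : Summable fun n : ℕ => ‖1 + ((n + 2 : ℕ) : ℂ) * μ‖ * ‖c (n + 2)‖) {z : ℂ}
    (hz : z ∈ ball (0 : ℂ) 1) :
    ‖tailSeries 2 c z + μ * (z * deriv (tailSeries 2 c) z)‖ ≤
      (∑' n : ℕ, ‖1 + ((n + 2 : ℕ) : ℂ) * μ‖ * ‖c (n + 2)‖) * ‖z‖ ^ 2 := by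
  have hz1 := (mem_ball_zero_iff.1 hz).le
  have hs1 := summable_tailSeries_two hc hz1
  have hs2 : Summable fun n : ℕ => ((n : ℂ) + 2) * c (n + 2) * z ^ (n + 1) := by
    refine Summable.of_norm_bounded hc fun n => ?_
    rw [norm_mul, norm_mul, norm_pow, norm_natCast_add_two]
    exact mul_le_of_le_one_right (by positivity) (pow_le_one₀ (norm_nonneg _) hz1)
  rw [(hasDerivAt_tailSeries_two hc hz).deriv, tailSeries, ← tsum_mul_left, ← tsum_mul_left,
    ← hs1.tsum_add ((hs2.mul_left z).mul_left μ), ← tsum_mul_right]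
  refine tsum_of_norm_bounded (hμ.mul_right _).hasSum fun n => ?_
  have : c (n + 2) * z ^ (n + 2) + μ * (z * (((n : ℂ) + 2) * c (n + 2) * z ^ (n + 1))) =
      (1 + ((n + 2 : ℕ) : ℂ) * μ) * c (n + 2) * z ^ (n + 2) := by
    push_cast; ring
  rw [this, norm_mul, norm_mul, norm_pow]
  exact mul_le_mul_of_nonneg_left
    (pow_le_pow_of_le_one (norm_nonneg _) hz1 (by omega)) (by positivity)

lemma norm_deriv_tailSeries_two_le {c : ℕ → ℂ}
    (hc : Summable fun n : ℕ => ((n : ℝ) + 2) * ‖c (n + 2)‖) {z : ℂ} (hz : z ∈ ball (0 : ℂ) 1) :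
    ‖deriv (tailSeries 2 c) z‖ ≤ (∑' n : ℕ, ((n : ℝ) + 2) * ‖c (n + 2)‖) * ‖z‖ := by
  have hz1 := (mem_ball_zero_iff.1 hz).le
  rw [(hasDerivAt_tailSeries_two hc hz).deriv, ← tsum_mul_right]
  refine tsum_of_norm_bounded (hc.mul_right _).hasSum fun n => ?_
  rw [norm_mul, norm_mul, norm_pow, norm_natCast_add_two]
  refine mul_le_mul_of_nonneg_left ?_ (by positivity)
  exact (pow_le_pow_of_le_one (norm_nonneg _) hz1 (by omega : 1 ≤ n + 1)).trans_eq (pow_one _)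

/-- Mean value inequality on a smaller disk. The factor `ρ < 1` supplies the strictness for
univalence when the coefficient inequality is an equality. -/
lemma norm_tailSeries_two_sub_le {c : ℕ → ℂ}
    (hc : Summable fun n : ℕ => ((n : ℝ) + 2) * ‖c (n + 2)‖) {ρ : ℝ} (hρ : ρ < 1) {z w : ℂ}
    (hz : ‖z‖ ≤ ρ) (hw : ‖w‖ ≤ ρ) :
    ‖tailSeries 2 c z - tailSeries 2 c w‖ ≤
      (∑' n : ℕ, ((n : ℝ) + 2) * ‖c (n + 2)‖) * ρ * ‖z - w‖ := by
  have hsub : closedBall (0 : ℂ) ρ ⊆ ball 0 1 := closedBall_subset_ball hρ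
  refine (convex_closedBall (0 : ℂ) ρ).norm_image_sub_le_of_norm_deriv_le (fun x hx => ?_)
    (fun x hx => ?_) (mem_closedBall_zero_iff.2 hw) (mem_closedBall_zero_iff.2 hz)
  · exact (hasDerivAt_tailSeries_two hc (hsub hx)).differentiableAt
  · exact (norm_deriv_tailSeries_two_le hc (hsub hx)).trans (mul_le_mul_of_nonneg_left
      (mem_closedBall_zero_iff.1 hx) (tsum_nonneg fun n => by positivity))

/-! ### The constants `A_n` and `B` -/

lemma norm_exp_neg_I_mul (lam : ℝ) : ‖exp (-(I * lam))‖ = 1 := by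
  rw [norm_exp]; simp

lemma two_mul_le_spiralA (lam : ℝ) (n : ℕ) : 2 * n ≤ spiralA lam n := by
  have h := norm_sub_le (1 + (n : ℂ) * exp (-(I * lam))) (1 - (n : ℂ) * exp (-(I * lam)))
  have h2 : (1 + (n : ℂ) * exp (-(I * lam))) - (1 - (n : ℂ) * exp (-(I * lam))) =
    2 * n * exp (-(I * lam)) := by ring
  rw [h2, norm_mul, norm_exp_neg_I_mul, norm_mul, norm_natCast] at h
  simpa [spiralA] using h

lemma spiralB_le_two (lam : ℝ) : spiralB lam ≤ 2 := by
  have h := norm_add_le (1 : ℂ) (exp (-(I * lam)))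
  rw [norm_exp_neg_I_mul, norm_one] at h
  have := norm_nonneg (1 - exp (-(I * lam)))
  rw [spiralB]
  linarith

/-- The squares of the two moduli differ by `4 cos λ > 0`. -/
lemma spiralB_pos {lam : ℝ} (hlam : lam ∈ Set.Ioo (-(Real.pi / 2)) (Real.pi / 2)) :
    0 < spiralB lam := by
  have hcos : 0 < Real.cos lam := Real.cos_pos_of_mem_Ioo hlam
  have hre : (exp (-(I * lam))).re = Real.cos lam := by
    rw [exp_re]; simp
  rw [spiralB, sub_pos]
  refine lt_of_pow_lt_pow_left₀ 2 (norm_nonneg _) ?_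
  rw [← normSq_eq_norm_sq, ← normSq_eq_norm_sq, normSq_add, normSq_sub]
  simp only [one_mul, conj_re, hre]
  linarith

/-! ### Sufficient coefficient condition -/

/-- The vector `v` with `h' v + conj (g' v) = -E` points into the disk through `z`. -/
lemma re_conj_mul_neg_of_re_pos {p q E z v : ℂ} (hJ : 0 < ‖p‖ ^ 2 - ‖q‖ ^ 2)
    (hE : 0 < (E * (starRingEnd ℂ) (z * p - (starRingEnd ℂ) (z * q))).re)
    (hv : v * p + (starRingEnd ℂ) (v * q) = -E) : ((starRingEnd ℂ) z * v).re < 0 := by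
  have hJ' : ((‖p‖ ^ 2 - ‖q‖ ^ 2 : ℝ) : ℂ) = p * (starRingEnd ℂ) p - q * (starRingEnd ℂ) q := by
    rw [mul_conj, mul_conj, normSq_eq_norm_sq, normSq_eq_norm_sq]; push_cast; rfl
  -- Cramer's rule: eliminating `conj v` between the equation and its conjugate gives `(|p|² - |q|²)
  -- v = -E conj p + conj (E q)`.
  have hre : (‖p‖ ^ 2 - ‖q‖ ^ 2) * ((starRingEnd ℂ) z * v).re =
      -(E * (starRingEnd ℂ) (z * p - (starRingEnd ℂ) (z * q))).re := by
    rw [← re_ofReal_mul, hJ']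
    have hE' : E = -(v * p + (starRingEnd ℂ) (v * q)) := by rw [hv, neg_neg]
    rw [hE']
    simp only [mul_re, mul_im, sub_re, sub_im, add_re, add_im, neg_re, neg_im, map_mul, map_sub,
      conj_re, conj_im]
    ring
  nlinarith

/-- A coefficient condition sufficient for hereditary spirallikeness. -/
theorem isHereditarilySpirallike_of_tsum_le {lam : ℝ} {α β : ℕ → ℂ}
    (hβ : spiralA lam 1 * ‖β 1‖ < spiralB lam)
    (hs : Summable fun n : ℕ => spiralA lam (n + 2) * (‖α (n + 2)‖ + ‖β (n + 2)‖))
    (hle : ∑' n : ℕ, spiralA lam (n + 2) * (‖α (n + 2)‖ + ‖β (n + 2)‖) ≤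
      spiralB lam - spiralA lam 1 * ‖β 1‖) :
    TailConverges 2 α ∧ TailConverges 1 β ∧ IsHereditarilySpirallike lam
      (fun z => z + tailSeries 2 α z + (starRingEnd ℂ) (tailSeries 1 β z)) := by
  have hA1 : 2 ≤ spiralA lam 1 := by simpa using two_mul_le_spiralA lam 1
  have hB2 := spiralB_le_two lam
  have hB0 : 0 < spiralB lam := lt_of_le_of_lt (by positivity) hβ
  have hA : ∀ n : ℕ, 2 * ((n : ℝ) + 2) ≤ spiralA lam (n + 2) := fun n => by
    simpa using two_mul_le_spiralA lam (n + 2)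
  have hsw : ∀ {w c : ℕ → ℝ}, (∀ n, 0 ≤ w n) → (∀ n, w n ≤ spiralA lam (n + 2)) → (∀ n, 0 ≤ c n) →
      (∀ n, c n ≤ ‖α (n + 2)‖ + ‖β (n + 2)‖) → Summable fun n => w n * c n := fun h1 h2 h3 h4 =>
    hs.of_nonneg_of_le (fun n => mul_nonneg (h1 n) (h3 n)) fun n =>
      mul_le_mul (h2 n) (h4 n) (h3 n) ((h1 n).trans (h2 n))
  have hαle : ∀ n, ‖α (n + 2)‖ ≤ ‖α (n + 2)‖ + ‖β (n + 2)‖ := fun n =>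
    le_add_of_nonneg_right (norm_nonneg _)
  have hβle : ∀ n, ‖β (n + 2)‖ ≤ ‖α (n + 2)‖ + ‖β (n + 2)‖ := fun n =>
    le_add_of_nonneg_left (norm_nonneg _)
  have hw0 : ∀ n : ℕ, (0 : ℝ) ≤ n + 2 := fun n => by positivity
  have hwA : ∀ n : ℕ, (n : ℝ) + 2 ≤ spiralA lam (n + 2) := fun n => by linarith [hA n, hw0 n]
  have hα2 : Summable fun n : ℕ => ((n : ℝ) + 2) * ‖α (n + 2)‖ :=
    hsw hw0 hwA (fun n => norm_nonneg _) hαle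
  have hβ2 : Summable fun n : ℕ => ((n : ℝ) + 2) * ‖β (n + 2)‖ :=
    hsw hw0 hwA (fun n => norm_nonneg _) hβle
  have hβ1 : ‖β 1‖ < 1 := by nlinarith [norm_nonneg (β 1)]
  set Sα := ∑' n : ℕ, ((n : ℝ) + 2) * ‖α (n + 2)‖
  set Sβ := ∑' n : ℕ, ((n : ℝ) + 2) * ‖β (n + 2)‖
  have hSα : 0 ≤ Sα := tsum_nonneg fun n => by positivity
  have hSβ : 0 ≤ Sβ := tsum_nonneg fun n => by positivity
  -- Follows from `A_n ≥ 2n ≥ nB`; it controls both the Jacobian and univalence.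
  have hS : Sα + Sβ ≤ 1 - ‖β 1‖ := by
    have h1 : spiralB lam * (Sα + Sβ) ≤ spiralB lam - spiralA lam 1 * ‖β 1‖ := by
      refine le_trans ?_ hle
      rw [← hα2.tsum_add hβ2, ← tsum_mul_left]
      refine ((hα2.add hβ2).mul_left _).tsum_le_tsum (fun n => ?_) hs
      rw [← mul_add, ← mul_assoc]
      refine mul_le_mul_of_nonneg_right ?_ (by positivity)
      nlinarith [hA n, hw0 n]
    have h2 : spiralB lam * (Sα + Sβ) ≤ spiralB lam * (1 - ‖β 1‖) := by
      nlinarith [norm_nonneg (β 1)]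
    exact le_of_mul_le_mul_left h2 hB0
  set h : ℂ → ℂ := fun z => z + tailSeries 2 α z with hh
  set g : ℂ → ℂ := fun z => tailSeries 1 β z with hg
  have hgeq : ∀ z ∈ ball (0 : ℂ) 1, g z = β 1 * z + tailSeries 2 β z := fun z hz =>
    tailSeries_one_eq hβ2 (mem_ball_zero_iff.1 hz).le
  have hhd : ∀ z ∈ ball (0 : ℂ) 1, HasDerivAt h (1 + deriv (tailSeries 2 α) z) z := fun z hz =>
    (hasDerivAt_id z).add (hasDerivAt_tailSeries_two hα2 hz).differentiableAt.hasDerivAt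
  have hgd : ∀ z ∈ ball (0 : ℂ) 1, HasDerivAt g (β 1 + deriv (tailSeries 2 β) z) z := by
    intro z hz
    have h1 : HasDerivAt (fun z => β 1 * z + tailSeries 2 β z)
        (β 1 + deriv (tailSeries 2 β) z) z :=
      (by simpa using (hasDerivAt_id z).const_mul (β 1) :
        HasDerivAt (fun z => β 1 * z) (β 1) z).add
        (hasDerivAt_tailSeries_two hβ2 hz).differentiableAt.hasDerivAt
    refine h1.congr_of_eventuallyEq ?_
    filter_upwards [isOpen_ball.mem_nhds hz] with y hy using hgeq y hy
  have hha : AnalyticOnNhd ℂ h (ball 0 1) := DifferentiableOn.analyticOnNhd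
    (fun z hz => (hhd z hz).differentiableAt.differentiableWithinAt) isOpen_ball
  have hga : AnalyticOnNhd ℂ g (ball 0 1) := DifferentiableOn.analyticOnNhd
    (fun z hz => (hgd z hz).differentiableAt.differentiableWithinAt) isOpen_ball
  have hT0 : ∀ c : ℕ → ℂ, tailSeries 2 c 0 = 0 := fun c => by simp [tailSeries]
  have h00 : (0 : ℂ) ∈ ball (0 : ℂ) 1 := mem_ball_self one_pos
  have hh0 : h 0 = 0 := by simp [hh, hT0]
  have hg0 : g 0 = 0 := by rw [hgeq 0 h00, hT0]; simp
  have hhd0 : deriv h 0 = 1 := by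
    have := norm_deriv_tailSeries_two_le hα2 h00
    rw [norm_zero, mul_zero] at this
    rw [(hhd 0 h00).deriv, norm_le_zero_iff.1 this, add_zero]
  have hJ : ∀ z ∈ ball (0 : ℂ) 1, 0 < ‖deriv h z‖ ^ 2 - ‖deriv g z‖ ^ 2 := by
    intro z hz
    have hz1 := mem_ball_zero_iff.1 hz
    have h1 := norm_deriv_tailSeries_two_le hα2 hz
    have h2 := norm_deriv_tailSeries_two_le hβ2 hz
    have h3 : 1 - ‖deriv (tailSeries 2 α) z‖ ≤ ‖deriv h z‖ := by
      rw [(hhd z hz).deriv]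
      simpa using norm_sub_le_norm_add (1 : ℂ) (deriv (tailSeries 2 α) z)
    have h4 : ‖deriv g z‖ ≤ ‖β 1‖ + ‖deriv (tailSeries 2 β) z‖ := by
      rw [(hgd z hz).deriv]
      exact norm_add_le _ _
    have h5 : (Sα + Sβ) * ‖z‖ ≤ (1 - ‖β 1‖) * ‖z‖ :=
      mul_le_mul_of_nonneg_right hS (norm_nonneg _)
    have h6 : (1 - ‖β 1‖) * ‖z‖ < 1 - ‖β 1‖ :=
      mul_lt_of_lt_one_right (by linarith) hz1
    have h7 : ‖deriv g z‖ < ‖deriv h z‖ := by linarith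
    exact sub_pos.2 (pow_lt_pow_left₀ h7 (norm_nonneg _) two_ne_zero)
  set f : ℂ → ℂ := fun z => z + tailSeries 2 α z + (starRingEnd ℂ) (tailSeries 1 β z) with hf
  have hinj : Set.InjOn f (ball 0 1) := by
    intro z hz w hw hzw
    set ρ := max ‖z‖ ‖w‖
    have hρ : ρ < 1 := max_lt (mem_ball_zero_iff.1 hz) (mem_ball_zero_iff.1 hw)
    have h1 := norm_tailSeries_two_sub_le hα2 hρ (le_max_left ‖z‖ ‖w‖) (le_max_right ‖z‖ ‖w‖)
    have h2 := norm_tailSeries_two_sub_le hβ2 hρ (le_max_left ‖z‖ ‖w‖) (le_max_right ‖z‖ ‖w‖)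
    have h3 : z - w = -(tailSeries 2 α z - tailSeries 2 α w) -
        (starRingEnd ℂ) (β 1 * (z - w)) -
        (starRingEnd ℂ) (tailSeries 2 β z - tailSeries 2 β w) := by
      have e1 := hgeq z hz
      have e2 := hgeq w hw
      simp only [hg] at e1 e2
      simp only [hf, e1, e2, map_add] at hzw
      simp only [mul_sub, map_sub]
      linear_combination hzw
    have h4 : ‖z - w‖ ≤ ‖tailSeries 2 α z - tailSeries 2 α w‖ + ‖β 1‖ * ‖z - w‖ +
        ‖tailSeries 2 β z - tailSeries 2 β w‖ := by
      conv_lhs => rw [h3]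
      refine (norm_sub_le _ _).trans ?_
      rw [norm_conj]
      gcongr
      refine (norm_sub_le _ _).trans ?_
      rw [norm_neg, norm_conj, norm_mul]
    have h5 : (Sα + Sβ) * ρ < 1 - ‖β 1‖ := by
      have hρ0 : 0 ≤ ρ := le_max_of_le_left (norm_nonneg z)
      nlinarith
    by_contra hne
    have h6 : 0 < ‖z - w‖ := norm_pos_iff.2 (sub_ne_zero.2 hne)
    nlinarith
  have hf0 : f 0 = 0 := by
    change h 0 + (starRingEnd ℂ) (g 0) = 0
    rw [hh0, hg0, map_zero, add_zero]
  set f' : ℂ → ℂ →L[ℝ] ℂ := fun z =>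
    (ContinuousLinearMap.toSpanSingleton ℂ (deriv h z)).restrictScalars ℝ +
      (conjCLE : ℂ →L[ℝ] ℂ).comp
        ((ContinuousLinearMap.toSpanSingleton ℂ (deriv g z)).restrictScalars ℝ) with hf'
  have hf'v : ∀ z v, f' z v = v * deriv h z + (starRingEnd ℂ) (v * deriv g z) := fun z v => rfl
  have hfs : ∀ z ∈ ball (0 : ℂ) 1, HasStrictFDerivAt f (f' z) z := fun z hz =>
    ((hha z hz).hasStrictDerivAt.hasStrictFDerivAt.restrictScalars ℝ).add
      ((conjCLE : ℂ →L[ℝ] ℂ).hasStrictFDerivAt.comp z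
        ((hga z hz).hasStrictDerivAt.hasStrictFDerivAt.restrictScalars ℝ))
  have hf'inj : ∀ z ∈ ball (0 : ℂ) 1, Function.Injective (f' z) := by
    intro z hz
    refine (injective_iff_map_eq_zero _).2 fun v hv => ?_
    rw [hf'v] at hv
    have h1 := congrArg norm (eq_neg_of_add_eq_zero_left hv)
    rw [norm_neg, norm_conj, norm_mul, norm_mul] at h1
    by_contra hne
    have h2 := mul_left_cancel₀ (norm_ne_zero_iff.2 hne) h1
    have h3 := hJ z hz
    rw [h2, sub_self] at h3
    exact lt_irrefl _ h3
  set e : ℂ := exp (-(I * lam)) with he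
  have hce : (starRingEnd ℂ) e = exp (I * lam) := by
    rw [he, ← exp_conj]; simp
  have hwt : ∀ n : ℕ, ‖1 + ((n + 2 : ℕ) : ℂ) * e‖ + ‖1 + ((n + 2 : ℕ) : ℂ) * (-e)‖ =
      spiralA lam (n + 2) := fun n => by
    rw [spiralA, mul_neg, ← sub_eq_add_neg]
  have hconj : ∀ (n : ℕ) (μ : ℂ), ‖1 + ((n + 2 : ℕ) : ℂ) * (starRingEnd ℂ) μ‖ =
      ‖1 + ((n + 2 : ℕ) : ℂ) * μ‖ := fun n μ => by
    rw [← norm_conj (1 + ((n + 2 : ℕ) : ℂ) * μ), map_add, map_mul, map_one, map_natCast]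
  have hwp : ∀ n : ℕ, ‖1 + ((n + 2 : ℕ) : ℂ) * e‖ ≤ spiralA lam (n + 2) := fun n => by
    linarith [hwt n, norm_nonneg (1 + ((n + 2 : ℕ) : ℂ) * (-e))]
  have hwm : ∀ n : ℕ, ‖1 + ((n + 2 : ℕ) : ℂ) * (-e)‖ ≤ spiralA lam (n + 2) := fun n => by
    linarith [hwt n, norm_nonneg (1 + ((n + 2 : ℕ) : ℂ) * e)]
  have hαp := hsw (fun n => norm_nonneg _) hwp (fun n => norm_nonneg _) hαle
  have hαm := hsw (fun n => norm_nonneg _) hwm (fun n => norm_nonneg _) hαle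
  have hβp := hsw (fun n => norm_nonneg _) hwp (fun n => norm_nonneg _) hβle
  have hβm := hsw (fun n => norm_nonneg _) hwm (fun n => norm_nonneg _) hβle
  have hsplit : (∑' n : ℕ, ‖1 + ((n + 2 : ℕ) : ℂ) * e‖ * ‖α (n + 2)‖) +
      (∑' n : ℕ, ‖1 + ((n + 2 : ℕ) : ℂ) * (-e)‖ * ‖α (n + 2)‖) +
      ((∑' n : ℕ, ‖1 + ((n + 2 : ℕ) : ℂ) * e‖ * ‖β (n + 2)‖) +
      (∑' n : ℕ, ‖1 + ((n + 2 : ℕ) : ℂ) * (-e)‖ * ‖β (n + 2)‖)) ≤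
      spiralB lam - spiralA lam 1 * ‖β 1‖ := by
    refine le_trans (le_of_eq ?_) hle
    rw [← hαp.tsum_add hαm, ← hβp.tsum_add hβm, ← (hαp.add hαm).tsum_add (hβp.add hβm)]
    refine tsum_congr fun n => ?_
    rw [← hwt n]
    ring
  have hdir : ∀ z ∈ ball (0 : ℂ) 1, z ≠ 0 → ∀ v, f' z v = -exp (I * lam) * f z →
      ((starRingEnd ℂ) z * v).re < 0 := by
    intro z hz hz0 v hv
    rw [hf'v, neg_mul] at hv
    refine re_conj_mul_neg_of_re_pos (hJ z hz) ?_ hv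
    have n1 := norm_tailSeries_two_add_le hα2 hαp hz
    have n2 := norm_tailSeries_two_add_le hα2 hαm hz
    have n3 := norm_tailSeries_two_add_le (μ := (starRingEnd ℂ) e) hβ2 (by simpa only [hconj]) hz
    have n4 := norm_tailSeries_two_add_le (μ := (starRingEnd ℂ) (-e)) hβ2
      (by simpa only [hconj]) hz
    simp only [hconj] at n3 n4
    set Up := ∑' n : ℕ, ‖1 + ((n + 2 : ℕ) : ℂ) * e‖ * ‖α (n + 2)‖
    set Um := ∑' n : ℕ, ‖1 + ((n + 2 : ℕ) : ℂ) * (-e)‖ * ‖α (n + 2)‖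
    set Vp := ∑' n : ℕ, ‖1 + ((n + 2 : ℕ) : ℂ) * e‖ * ‖β (n + 2)‖
    set Vm := ∑' n : ℕ, ‖1 + ((n + 2 : ℕ) : ℂ) * (-e)‖ * ‖β (n + 2)‖
    have hfz : f z = z + tailSeries 2 α z + (starRingEnd ℂ) (β 1 * z + tailSeries 2 β z) := by
      rw [← hgeq z hz]
    rw [(hhd z hz).deriv, (hgd z hz).deriv]
    set p := deriv (tailSeries 2 α) z
    set q := deriv (tailSeries 2 β) z
    -- `iD` is the angular derivative of `f`.
    set D := z * (1 + p) - (starRingEnd ℂ) (z * (β 1 + q)) with hD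
    have e1 : f z + e * D = (1 + e) * z + (tailSeries 2 α z + e * (z * p)) +
        (1 - e) * (starRingEnd ℂ) (β 1 * z) +
        (starRingEnd ℂ) (tailSeries 2 β z + (starRingEnd ℂ) (-e) * (z * q)) := by
      rw [hfz, hD]
      simp only [map_add, map_mul, map_neg, conj_conj]
      ring
    have e2 : f z - e * D = (1 - e) * z + (tailSeries 2 α z + (-e) * (z * p)) +
        (1 + e) * (starRingEnd ℂ) (β 1 * z) +
        (starRingEnd ℂ) (tailSeries 2 β z + (starRingEnd ℂ) e * (z * q)) := by
      rw [hfz, hD]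
      simp only [map_add, map_mul, conj_conj]
      ring
    have l1 : ‖1 + e‖ * ‖z‖ ≤ ‖f z + e * D‖ + Up * ‖z‖ ^ 2 + ‖1 - e‖ * (‖β 1‖ * ‖z‖) +
        Vm * ‖z‖ ^ 2 := by
      have e1' : (1 + e) * z = f z + e * D - (tailSeries 2 α z + e * (z * p)) -
        (1 - e) * (starRingEnd ℂ) (β 1 * z) -
        (starRingEnd ℂ) (tailSeries 2 β z + (starRingEnd ℂ) (-e) * (z * q)) := by
        rw [e1]; ring
      rw [← norm_mul, e1']
      refine (norm_sub_le _ _).trans (add_le_add ?_ (by rw [norm_conj]; exact n4))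
      refine (norm_sub_le _ _).trans (add_le_add ?_ (by rw [norm_mul, norm_conj, norm_mul]))
      exact (norm_sub_le _ _).trans (add_le_add le_rfl n1)
    have l2 : ‖f z - e * D‖ ≤ ‖1 - e‖ * ‖z‖ + Um * ‖z‖ ^ 2 + ‖1 + e‖ * (‖β 1‖ * ‖z‖) +
        Vp * ‖z‖ ^ 2 := by
      rw [e2]
      refine (norm_add_le _ _).trans (add_le_add ?_ (by rw [norm_conj]; exact n3))
      refine (norm_add_le _ _).trans (add_le_add ?_ (by rw [norm_mul, norm_conj, norm_mul]))
      exact (norm_add_le _ _).trans (add_le_add (norm_mul _ _).le n2)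
    -- Subtracting `l2` from `l1`, the gap is at least `δ|z| - δ|z|² > 0` with `δ = B - A_1|β_1|`.
    have hlt : ‖f z - e * D‖ < ‖f z + e * D‖ := by
      have hBe : spiralB lam = ‖1 + e‖ - ‖1 - e‖ := rfl
      have hAe : spiralA lam 1 = ‖1 + e‖ + ‖1 - e‖ := by simp [spiralA, he]
      have hδ : 0 < spiralB lam - spiralA lam 1 * ‖β 1‖ := sub_pos.2 hβ
      have hzp : 0 < ‖z‖ := norm_pos_iff.2 hz0
      have hz1 := mem_ball_zero_iff.1 hz
      have m1 := mul_le_mul_of_nonneg_right hsplit (sq_nonneg ‖z‖)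
      have m2 := mul_pos (mul_pos hδ hzp) (sub_pos.2 hz1)
      rw [hBe, hAe] at m1 m2
      nlinarith
    -- Polarization: the squares differ by `4 Re(f conj(eD)) = 4 Re(e^{iλ} f conj D)`.
    have hsq := pow_lt_pow_left₀ hlt (norm_nonneg _) two_ne_zero
    rw [← normSq_eq_norm_sq, ← normSq_eq_norm_sq, normSq_add, normSq_sub,
      map_mul (starRingEnd ℂ), hce] at hsq
    have : exp (I * lam) * f z * (starRingEnd ℂ) D =
        f z * (exp (I * lam) * (starRingEnd ℂ) D) := by ring
    rw [this]
    linarith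
  refine ⟨fun z hz => summable_tailSeries_two hα2 (mem_ball_zero_iff.1 hz).le, fun z hz => ?_,
    ⟨h, g, hha, hga, hh0, hhd0, hg0, fun z _ => rfl, hJ⟩, hinj, fun r hr hr1 =>
    isSpirallikeDomain_image_ball hfs hinj hf0 hf'inj hdir hr hr1⟩
  exact (summable_nat_add_iff (f := fun n => β (n + 1) * z ^ (n + 1)) 1).1
    (summable_tailSeries_two hβ2 (mem_ball_zero_iff.1 hz).le)

/-! ### Transfer of the coefficient inequality through the multipliers `d_n` -/

theorem mainTheorem8 (lam : ℝ) (hlam : lam ∈ Set.Ioo (-(Real.pi / 2)) (Real.pi / 2))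
    (a b d : ℕ → ℂ)
    (hd : ∀ n : ℕ, 1 ≤ n → ‖d n‖ ≤ n * spiralB lam / spiralA lam n)
    (H G : ℂ → ℂ)
    (hHconv : TailConverges 2 (fun n => (‖a n‖ : ℂ)))
    (hH : ∀ z ∈ ball (0 : ℂ) 1, H z = z - tailSeries 2 (fun n => (‖a n‖ : ℂ)) z)
    (hGconv : TailConverges 1 (fun n => (‖b n‖ : ℂ)))
    (hG : ∀ z ∈ ball (0 : ℂ) 1, G z = tailSeries 1 (fun n => (‖b n‖ : ℂ)) z)
    (hb1 : ‖b 1‖ < 1)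
    (hF : ∀ ε : ℂ, ‖ε‖ = 1 → ∃ F : ℂ → ℂ,
      IsPowerTransform (exp (I * lam) * (Real.cos lam : ℂ)) (fun z => H z + ε * G z) F ∧
        IsAnalyticSpirallike lam F) :
    TailConverges 2 (fun n => d n * a n) ∧ TailConverges 1 (fun n => d n * b n) ∧
      IsHereditarilySpirallike lam (fun z =>
        z + tailSeries 2 (fun n => d n * a n) z +
          (starRingEnd ℂ) (tailSeries 1 (fun n => d n * b n) z)) := by
  obtain ⟨F, hT, hFs⟩ := hF (-1) (by simp)
  obtain ⟨hsum, hle⟩ :=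
    summable_and_tsum_le_of_isPowerTransform hlam hHconv hH hGconv hG hb1 hT hFs
  have hB := spiralB_pos hlam
  have hd' : ∀ n : ℕ, 1 ≤ n → spiralA lam n * ‖d n‖ ≤ n * spiralB lam := fun n hn => by
    have hA : 0 < spiralA lam n := by
      have h1 := two_mul_le_spiralA lam n
      have h2 : (1 : ℝ) ≤ n := by exact_mod_cast hn
      linarith
    have := hd n hn
    rw [le_div_iff₀ hA] at this
    linarith
  have h1 : spiralA lam 1 * ‖d 1 * b 1‖ ≤ spiralB lam * ‖b 1‖ := by
    rw [norm_mul, ← mul_assoc]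
    exact mul_le_mul_of_nonneg_right (by simpa using hd' 1 le_rfl) (norm_nonneg _)
  have hterm : ∀ n : ℕ, spiralA lam (n + 2) *
      (‖d (n + 2) * a (n + 2)‖ + ‖d (n + 2) * b (n + 2)‖) ≤
      spiralB lam * (((n : ℝ) + 2) * (‖a (n + 2)‖ + ‖b (n + 2)‖)) := fun n => by
    rw [norm_mul, norm_mul, ← mul_add, ← mul_assoc, ← mul_assoc]
    refine mul_le_mul_of_nonneg_right ?_ (by positivity)
    have := hd' (n + 2) (by omega)
    push_cast at this
    linarith
  have hnn : ∀ n : ℕ, 0 ≤ spiralA lam (n + 2) *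
      (‖d (n + 2) * a (n + 2)‖ + ‖d (n + 2) * b (n + 2)‖) := fun n =>
    mul_nonneg (add_nonneg (norm_nonneg _) (norm_nonneg _)) (by positivity)
  have hs := (hsum.mul_left (spiralB lam)).of_nonneg_of_le hnn hterm
  refine isHereditarilySpirallike_of_tsum_le (α := fun n => d n * a n) (β := fun n => d n * b n)
    (h1.trans_lt (mul_lt_of_lt_one_right hB hb1)) hs ?_
  have h2 := hs.tsum_le_tsum hterm (hsum.mul_left (spiralB lam))
  rw [tsum_mul_left] at h2
  have h3 := mul_le_mul_of_nonneg_left hle hB.le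
  linarith
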